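/- Let $f(x,y)=\exp\{-\tfrac12|x-y|^2\}$ be the Gaussian RBF kernel on $\mathbb{R}$, let $\mathcal{Z}=[a,b]$ with $a<b$, and let $\mathcal{B}=[c-R,c+R]\subset\mathbb{R}$ be any closed ball containing $\mathcal{Z}$. Let $u_1,u_2,\ldots$ and $\gamma_1,\gamma_2,\ldots>0$ be the orthonormal eigenfunctions and corresponding positive eigenvalues of $f$ with respect to Lebesgue measure on $\mathcal{B}$; that is, the $u_k$ are orthonormal in $L^2(\mathcal{B})$, $\int_{\mathcal{B}}f(x,y)u_k(y)\,\mathrm{d}y=\gamma_k u_k(x)$ for every $x\in\mathcal{B}$, and the system is maximal: an eigenfunction with a positive eigenvalue cannot be orthogonal to all $u_k$. Such an infinite sequence exists. For every such choice, define the Mercer feature map by $$\phi(z)=\bigl(\gamma_1^{1/2}u_1(z),\ \gamma_2^{1/2}u_2(z),\ \ldots\bigr),\qquad z\in\mathcal{Z}.$$ Then $\phi(z)\in\ell^2$ for all $z\in\mathcal{Z}$; the map $\phi:\mathcal{Z}\to\ell^2$ is a homeomorphism onto its image $\phi(\mathcal{Z})$ (with the $\ell^2$-norm topology); and $\phi$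 is non-distortive: for every continuously differentiable curve $\eta:[0,1]\to\mathcal{Z}$, the image curve $\phi\circ\eta:[0,1]\to\ell^2$ is continuously differentiable and $$\int_0^1\Bigl\|\frac{\mathrm{d}}{\mathrm{d}t}\phi\{\eta(t)\}\Bigr\|_{\ell^2}\,\mathrm{d}t=\int_0^1\Bigl|\frac{\mathrm{d}\eta}{\mathrm{d}t}\Bigr|\,\mathrm{d}t .$$ -/

import Mathlib

open Set MeasureTheory

noncomputable section

/-- The Gaussian radial basis function kernel `f(x, y) = exp(-|x - y|² / 2)` on the real line. -/
def gaussianRBF (x y : ℝ) : ℝ := Real.exp (-(1 / 2) * |x - y| ^ 2)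

/-- `v` is square integrable on `B` (Lebesgue measure) and solves the eigenvalue equation
`∫_B f(x, y) v(y) dy = lam * v(x)` at every point `x` of `B`. For `lam ≠ 0` the equation at every
point selects the version of an `L²` eigenfunction given by the integral operator itself
(for a continuous kernel and compact `B`, the continuous version). The function `v = 0` is not
excluded here. -/
def SolvesEigenEquation (f : ℝ → ℝ → ℝ) (B : Set ℝ) (lam : ℝ) (v : ℝ → ℝ) : Prop :=
  MemLp v 2 (volume.restrict B) ∧ ∀ x ∈ B, ∫ y in B, f x y * v y = lam * v x

/-- `u 0, u 1, …` are the orthonormal eigenfunctions of the kernel `f` with respect to Lebesgue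
measure on `B`, with corresponding positive eigenvalues `gam 0, gam 1, …` (repeated according to
multiplicity, in any order). -/
structure IsMercerSystem (f : ℝ → ℝ → ℝ) (B : Set ℝ) (gam : ℕ → ℝ) (u : ℕ → ℝ → ℝ) : Prop where
  /-- the eigenvalues are positive -/
  pos : ∀ k, 0 < gam k
  /-- each `u k` is an eigenfunction with eigenvalue `gam k` -/
  eigen : ∀ k, SolvesEigenEquation f B (gam k) (u k)
  /-- the eigenfunctions are orthonormal in `L²(B)` -/
  orthonormal : ∀ j k, ∫ x in B, u j x * u k x = if j = k then 1 else 0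
  /-- no eigenfunction with a positive eigenvalue is missing: one that is orthogonal to
  every `u k` vanishes -/
  maximal : ∀ (lam : ℝ) (v : ℝ → ℝ), 0 < lam → SolvesEigenEquation f B lam v →
    (∀ k, ∫ x in B, u k x * v x = 0) → ∀ x ∈ B, v x = 0

/-- The sequence `(√(gam 0) * u 0 z, √(gam 1) * u 1 z, …)`. -/
def mercerCoord (gam : ℕ → ℝ) (u : ℕ → ℝ → ℝ) (z : ℝ) : ℕ → ℝ :=
  fun k => Real.sqrt (gam k) * u k z

open Classical in
/-- The Mercer feature map `φ(z) = (√(gam k) * u k z)_k`, with values in the Hilbert space `ℓ²`.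
Where the sequence is not square summable it takes the dummy value `0`. -/
def mercerMap (gam : ℕ → ℝ) (u : ℕ → ℝ → ℝ) (z : ℝ) : lp (fun _ : ℕ => ℝ) 2 :=
  if h : Memℓp (mercerCoord gam u z) 2 then ⟨mercerCoord gam u z, h⟩ else 0

/-- The length `∫₀¹ ‖c'(t)‖ dt` of a continuously differentiable curve `c` on `[0, 1]`
(one-sided derivatives at the end points). -/
def curveLength {E : Type*} [NormedAddCommGroup E] [NormedSpace ℝ E] (c : ℝ → E) : ℝ :=
  ∫ t in (0 : ℝ)..1, ‖derivWithin c (Icc 0 1) t‖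

/-- `Φ` is non-distortive on `Z`: every continuously differentiable curve `η : [0, 1] → Z` has
a continuously differentiable image `Φ ∘ η`, of the same length. -/
def IsNonDistortiveOn {E : Type*} [NormedAddCommGroup E] [NormedSpace ℝ E]
    (Φ : ℝ → E) (Z : Set ℝ) : Prop :=
  ∀ η : ℝ → ℝ, ContDiffOn ℝ 1 η (Icc 0 1) → MapsTo η (Icc 0 1) Z →
    ContDiffOn ℝ 1 (Φ ∘ η) (Icc 0 1) ∧ curveLength (Φ ∘ η) = curveLength η

end

/-! The kernel has the explicit feature map ψ(x) = (xⁿ exp(-x²/2)/√n!)ₙ, with ⟪ψ(x), ψ(y)⟫ = f(x,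
y). It is injective and C¹, and ‖ψ'(x)‖ = 1 because ∂ₓ∂ᵧf = 1 on the diagonal. It remains to carry
this over to φ without Mercer's theorem. Let S : ℓ² → L²(B) be h ↦ ⟪ψ(·), h⟫. The integral operator
is T = S S*, and the vectors wₖ = γₖ^(-1/2) S*uₖ are orthonormal with ⟪wₖ, ψ(x)⟫ = √γₖ uₖ(x). Hence
φ = U ∘ ψ on B, where U takes coordinates along w and is isometric on the closed span of w
(`Orthonormal.exists_coordinates`). If g is orthogonal to every wₖ, then S g is orthogonal to every
uₖ and to ker T, so S g = 0 by the spectral theorem (`eq_zero_of_orthogonal_eigenvectors`). By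
continuity ⟪ψ(x), g⟫ = 0 on all of B, and differentiation gives ⟪ψ'(x), g⟫ = 0. So U preserves the
norms of increments of ψ and of ψ' (`IsMercerSystem.exists_factorization`). For existence, Zorn's
lemma gives a maximal orthonormal set of eigenvectors, which is shown to be countable and infinite.
-/

/-! ### The Taylor feature map and its derivative. -/

open scoped Nat in
/-- The `n`-th coordinate `xⁿ exp(-x²/2) / √n!` of the Taylor feature map of the Gaussian kernel. -/
noncomputable def gaussCoord (x : ℝ) (n : ℕ) : ℝ :=
  x ^ n * Real.exp (-(x ^ 2 / 2)) / Real.sqrt (n ! : ℝ)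

theorem gaussCoord_succ (x : ℝ) (n : ℕ) :
    Real.sqrt (n + 1) * gaussCoord x (n + 1) = x * gaussCoord x n := by
  have h1 : (0 : ℝ) < n + 1 := by positivity
  have h2 := Real.sqrt_pos.2 h1
  have h3 : (0 : ℝ) < Real.sqrt (n.factorial : ℝ) := Real.sqrt_pos.2 (by positivity)
  simp only [gaussCoord, Nat.factorial_succ, Nat.cast_mul, Nat.cast_add, Nat.cast_one]
  rw [Real.sqrt_mul h1.le]
  field_simp
  ring

theorem gaussCoord_mul_succ (x y : ℝ) (n : ℕ) :
    ((n : ℝ) + 1) * (gaussCoord x (n + 1) * gaussCoord y (n + 1)) =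
      x * y * (gaussCoord x n * gaussCoord y n) := by
  have h1 : (0 : ℝ) ≤ n + 1 := by positivity
  calc _ = (Real.sqrt (n + 1) * gaussCoord x (n + 1)) *
        (Real.sqrt (n + 1) * gaussCoord y (n + 1)) := by
        nth_rewrite 1 [← Real.mul_self_sqrt h1]; ring
    _ = _ := by rw [gaussCoord_succ, gaussCoord_succ]; ring

theorem hasSum_gaussCoord_mul (x y : ℝ) :
    HasSum (fun n => gaussCoord x n * gaussCoord y n) (gaussianRBF x y) := by
  have h := (NormedSpace.expSeries_div_hasSum_exp (x * y)).mul_left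
    (Real.exp (-(x ^ 2 / 2)) * Real.exp (-(y ^ 2 / 2)))
  rw [← Real.exp_eq_exp_ℝ] at h
  convert! h using 1
  · ext n
    have h3 : Real.sqrt (n.factorial : ℝ) * Real.sqrt (n.factorial : ℝ) = n.factorial :=
      Real.mul_self_sqrt (by positivity)
    simp only [gaussCoord]
    rw [div_mul_div_comm, h3]
    ring
  · rw [gaussianRBF, ← Real.exp_add, ← Real.exp_add, sq_abs]
    ring_nf

theorem hasSum_natCast_mul_gaussCoord_mul (x y : ℝ) :
    HasSum (fun n : ℕ => (n : ℝ) * (gaussCoord x n * gaussCoord y n))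
      (x * y * gaussianRBF x y) := by
  rw [← hasSum_nat_add_iff' 1]
  simpa [gaussCoord_mul_succ] using (hasSum_gaussCoord_mul x y).mul_left (x * y)

theorem memℓp_two_of_summable_mul_self {f : ℕ → ℝ} (h : Summable fun n => f n * f n) :
    Memℓp f 2 := by
  refine memℓp_gen ?_
  simpa [← pow_two] using h

/-- The Taylor feature map `x ↦ (xⁿ exp(-x²/2) / √n!)ₙ` of the Gaussian kernel. -/
noncomputable def gaussFeature (x : ℝ) : lp (fun _ : ℕ => ℝ) 2 :=
  ⟨gaussCoord x, memℓp_two_of_summable_mul_self (hasSum_gaussCoord_mul x x).summable⟩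

/-- The sequence `(√n ψₙ₋₁(x))ₙ`, where `ψ` is the Taylor feature map. -/
noncomputable def gaussShiftCoord (x : ℝ) : ℕ → ℝ
  | 0 => 0
  | n + 1 => Real.sqrt (n + 1) * gaussCoord x n

theorem hasSum_gaussShiftCoord_mul_self (x y : ℝ) :
    HasSum (fun n => gaussShiftCoord x n * gaussShiftCoord y n)
      ((1 + x * y) * gaussianRBF x y) := by
  rw [← hasSum_nat_add_iff' 1]
  have := (hasSum_gaussCoord_mul x y).add (hasSum_natCast_mul_gaussCoord_mul x y)
  convert! this using 1
  · ext n
    have h1 : (0 : ℝ) ≤ n + 1 := by positivity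
    calc _ = (Real.sqrt (n + 1) * Real.sqrt (n + 1)) * (gaussCoord x n * gaussCoord y n) := by
          simp only [gaussShiftCoord]; ring
      _ = _ := by rw [Real.mul_self_sqrt h1]; ring
  · simp [gaussShiftCoord]; ring

theorem hasSum_gaussCoord_mul_gaussShiftCoord (x y : ℝ) :
    HasSum (fun n => gaussCoord x n * gaussShiftCoord y n) (x * gaussianRBF x y) := by
  rw [← hasSum_nat_add_iff' 1]
  convert! (hasSum_gaussCoord_mul x y).mul_left x using 1
  · ext n
    simp only [gaussShiftCoord]
    rw [← mul_assoc, mul_comm (gaussCoord x (n + 1)), gaussCoord_succ, mul_assoc]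
  · simp [gaussShiftCoord]

/-- The sequence `gaussShiftCoord x` as a vector of `ℓ²`. -/
noncomputable def gaussShift (x : ℝ) : lp (fun _ : ℕ => ℝ) 2 :=
  ⟨gaussShiftCoord x,
    memℓp_two_of_summable_mul_self (hasSum_gaussShiftCoord_mul_self x x).summable⟩

/-- The derivative of the Taylor feature map. -/
noncomputable def gaussFeatureDeriv (x : ℝ) : lp (fun _ : ℕ => ℝ) 2 :=
  gaussShift x - x • gaussFeature x

theorem inner_gaussFeature (x y : ℝ) :
    inner ℝ (gaussFeature x) (gaussFeature y) = gaussianRBF x y := by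
  rw [lp.inner_eq_tsum, ← (hasSum_gaussCoord_mul x y).tsum_eq]
  simp [gaussFeature, mul_comm]

theorem inner_gaussFeature_gaussShift (x y : ℝ) :
    inner ℝ (gaussFeature x) (gaussShift y) = x * gaussianRBF x y := by
  rw [lp.inner_eq_tsum, ← (hasSum_gaussCoord_mul_gaussShiftCoord x y).tsum_eq]
  simp [gaussFeature, gaussShift, mul_comm]

theorem inner_gaussShift (x y : ℝ) :
    inner ℝ (gaussShift x) (gaussShift y) = (1 + x * y) * gaussianRBF x y := by
  rw [lp.inner_eq_tsum, ← (hasSum_gaussShiftCoord_mul_self x y).tsum_eq]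
  simp [gaussShift, mul_comm]

theorem gaussianRBF_comm (x y : ℝ) : gaussianRBF x y = gaussianRBF y x := by
  simp [gaussianRBF, abs_sub_comm]

theorem gaussianRBF_self (x : ℝ) : gaussianRBF x x = 1 := by
  simp [gaussianRBF]

theorem inner_gaussFeature_gaussFeatureDeriv (x y : ℝ) :
    inner ℝ (gaussFeature x) (gaussFeatureDeriv y) = (x - y) * gaussianRBF x y := by
  rw [gaussFeatureDeriv, inner_sub_right, inner_smul_right, inner_gaussFeature_gaussShift,
    inner_gaussFeature]
  ring

/-- The right-hand side is ∂ₓ∂ᵧf; its diagonal value 1 is the unit speed behind non-distortion. -/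
theorem inner_gaussFeatureDeriv (x y : ℝ) :
    inner ℝ (gaussFeatureDeriv x) (gaussFeatureDeriv y) =
      (1 - (x - y) ^ 2) * gaussianRBF x y := by
  rw [gaussFeatureDeriv, inner_sub_left, inner_smul_left, inner_gaussFeature_gaussFeatureDeriv,
    gaussFeatureDeriv, inner_sub_right, inner_smul_right, inner_gaussShift,
    real_inner_comm, inner_gaussFeature_gaussShift, gaussianRBF_comm y x]
  simp only [conj_trivial]
  ring

theorem norm_gaussFeature (x : ℝ) : ‖gaussFeature x‖ = 1 := by
  rw [← sq_eq_sq₀ (norm_nonneg _) zero_le_one, ← real_inner_self_eq_norm_sq, inner_gaussFeature,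
    gaussianRBF_self, one_pow]

theorem norm_gaussFeatureDeriv (x : ℝ) : ‖gaussFeatureDeriv x‖ = 1 := by
  rw [← sq_eq_sq₀ (norm_nonneg _) zero_le_one, ← real_inner_self_eq_norm_sq,
    inner_gaussFeatureDeriv, gaussianRBF_self]
  norm_num

theorem gaussFeature_injective : Function.Injective gaussFeature := by
  intro x y h
  have h1 := inner_gaussFeature x y
  rw [h, inner_gaussFeature, gaussianRBF_self, gaussianRBF, eq_comm, Real.exp_eq_one_iff] at h1
  have h2 : |x - y| ^ 2 = 0 := by linarith
  exact sub_eq_zero.1 (abs_eq_zero.1 (pow_eq_zero_iff two_ne_zero |>.1 h2))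

/-- With d = y - x the squared norm is 2 + d² - 2(1 + d²) exp(-d²/2), and exp(-d²/2) ≥ 1 - d²/2
bounds it by exactly d⁴. -/
theorem norm_gaussFeature_sub_sub_le (x y : ℝ) :
    ‖gaussFeature y - gaussFeature x - (y - x) • gaussFeatureDeriv x‖ ≤ |y - x| ^ 2 := by
  rw [← sq_le_sq₀ (norm_nonneg _) (by positivity), norm_sub_sq_real, norm_sub_sq_real,
    inner_smul_right, inner_sub_left, inner_gaussFeature_gaussFeatureDeriv,
    inner_gaussFeature_gaussFeatureDeriv, norm_smul, norm_gaussFeature, norm_gaussFeature,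
    norm_gaussFeatureDeriv, inner_gaussFeature, Real.norm_eq_abs, sq_abs, mul_one, sq_abs]
  have h1 : 1 - (y - x) ^ 2 / 2 ≤ gaussianRBF y x := by
    rw [gaussianRBF, sq_abs]
    linarith [Real.add_one_le_exp (-(1 / 2) * (y - x) ^ 2)]
  nlinarith [mul_le_mul_of_nonneg_left h1 (by positivity : (0 : ℝ) ≤ 2 + 2 * (y - x) ^ 2)]

theorem hasDerivAt_gaussFeature (x : ℝ) : HasDerivAt gaussFeature (gaussFeatureDeriv x) x := by
  rw [hasDerivAt_iff_isLittleO]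
  refine Asymptotics.IsBigO.trans_isLittleO (g := fun y => ‖y - x‖ ^ 2) ?_
    (Asymptotics.isLittleO_pow_sub_sub x one_lt_two)
  refine Asymptotics.IsBigO.of_bound 1 (Filter.Eventually.of_forall fun y => ?_)
  simpa using norm_gaussFeature_sub_sub_le x y

theorem continuous_gaussFeature : Continuous gaussFeature :=
  continuous_iff_continuousAt.2 fun x => (hasDerivAt_gaussFeature x).continuousAt

theorem continuous_gaussFeatureDeriv : Continuous gaussFeatureDeriv := by
  rw [continuous_iff_continuousAt]
  intro x
  rw [ContinuousAt, tendsto_iff_norm_sub_tendsto_zero]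
  have key : ∀ y, ‖gaussFeatureDeriv y - gaussFeatureDeriv x‖ =
      Real.sqrt (2 - 2 * ((1 - (y - x) ^ 2) * gaussianRBF y x)) := by
    intro y
    rw [← Real.sqrt_sq (norm_nonneg _), norm_sub_sq_real, norm_gaussFeatureDeriv,
      norm_gaussFeatureDeriv, inner_gaussFeatureDeriv]
    ring_nf
  simp only [key]
  have hc : Continuous fun y =>
      Real.sqrt (2 - 2 * ((1 - (y - x) ^ 2) * gaussianRBF y x)) := by
    unfold gaussianRBF; fun_prop
  have := hc.tendsto x
  simpa [gaussianRBF_self] using this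

/-! ### The integral operator as S S*, and its compactness. -/

/-- An operator on `ℓ²` whose values on the standard basis are absolutely summable is compact. -/
theorem isCompactOperator_of_summable_norm_single {F : Type*} [NormedAddCommGroup F]
    [NormedSpace ℝ F] [CompleteSpace F] (C : lp (fun _ : ℕ => ℝ) 2 →L[ℝ] F)
    (hC : Summable fun n => ‖C (lp.single 2 n 1)‖) : IsCompactOperator C := by
  let r : ℕ → lp (fun _ : ℕ => ℝ) 2 →L[ℝ] F := fun n =>
    (innerSL ℝ (lp.single 2 n (1 : ℝ))).smulRight (C (lp.single 2 n 1))
  have hr : ∀ n h, r n h = C (lp.single 2 n (h n)) := by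
    intro n h
    have : lp.single 2 n (h n) = h n • lp.single (E := fun _ : ℕ => ℝ) 2 n (1 : ℝ) := by
      rw [← lp.single_smul, smul_eq_mul, mul_one]
    rw [this, map_smul]
    simp [r, lp.inner_single_left]
  have hs : Summable r := by
    refine Summable.of_norm_bounded hC fun n => ?_
    refine (ContinuousLinearMap.norm_smulRight_apply _ _).trans_le ?_
    simp [lp.norm_single]
  have hsum : ∑' n, r n = C := by
    ext h
    have h1 : HasSum (fun n => r n h) ((∑' n, r n) h) :=
      hs.hasSum.mapL (ContinuousLinearMap.apply ℝ F h)
    simp only [hr] at h1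
    have h2 : HasSum (fun n => lp.single 2 n (h n)) h := lp.hasSum_single ENNReal.ofNat_ne_top h
    have h3 : HasSum (fun n => C (lp.single 2 n (h n))) (C h) := h2.mapL C
    exact h1.unique h3
  -- `C` is the operator-norm limit of finite sums of the rank-one operators `r n`.
  refine isCompactOperator_of_tendsto (hsum ▸ hs.hasSum) (Filter.Eventually.of_forall fun s => ?_)
  classical
  induction s using Finset.induction_on with
  | empty => simpa using isCompactOperator_zero
  | insert n s hn ih =>
    rw [Finset.sum_insert hn]
    refine IsCompactOperator.add ?_ ih
    have h1 : IsCompactOperator (innerSL ℝ (lp.single (E := fun _ : ℕ => ℝ) 2 n (1 : ℝ))) :=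
      isCompactOperator_of_locallyCompactSpace_dom _
    exact h1.clm_comp (ContinuousLinearMap.toSpanSingleton ℝ (C (lp.single 2 n 1)))

section Operator

variable (μ : Measure ℝ) [IsFiniteMeasure μ]

theorem memLp_inner_gaussFeature (h : lp (fun _ : ℕ => ℝ) 2) :
    MemLp (fun x => inner ℝ (gaussFeature x) h) 2 μ := by
  refine MemLp.of_bound (continuous_gaussFeature.inner continuous_const).aestronglyMeasurable ‖h‖
    (Filter.Eventually.of_forall fun x => ?_)
  simpa [norm_gaussFeature] using norm_inner_le_norm (𝕜 := ℝ) (gaussFeature x) h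

/-- The operator `ℓ² → L²(μ)` sending `h` to the function `x ↦ ⟪ψ(x), h⟫`. -/
noncomputable def gaussSynthesis : lp (fun _ : ℕ => ℝ) 2 →L[ℝ] Lp ℝ 2 μ :=
  LinearMap.mkContinuous
    { toFun := fun h => (memLp_inner_gaussFeature μ h).toLp _
      map_add' := fun h k => by
        rw [← MemLp.toLp_add]
        congr 1
        ext x
        exact inner_add_right _ _ _
      map_smul' := fun r h => by
        rw [RingHom.id_apply, ← MemLp.toLp_const_smul]
        congr 1
        ext x
        exact inner_smul_right _ _ _ }
    (measureUnivNNReal μ ^ (2 : ENNReal).toReal⁻¹) (fun h => by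
      refine Lp.norm_le_of_ae_bound (norm_nonneg h) ?_
      filter_upwards [(memLp_inner_gaussFeature μ h).coeFn_toLp] with x hx
      simp only [LinearMap.coe_mk, AddHom.coe_mk]
      rw [hx]
      simpa [norm_gaussFeature] using norm_inner_le_norm (𝕜 := ℝ) (gaussFeature x) h)

theorem gaussSynthesis_coeFn (h : lp (fun _ : ℕ => ℝ) 2) :
    gaussSynthesis μ h =ᵐ[μ] fun x => inner ℝ (gaussFeature x) h :=
  (memLp_inner_gaussFeature μ h).coeFn_toLp

/-- The adjoint of `gaussSynthesis`, `v ↦ ∫ v(x) ψ(x) dμ(x)`. -/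
noncomputable def gaussAnalysis : Lp ℝ 2 μ →L[ℝ] lp (fun _ : ℕ => ℝ) 2 :=
  (gaussSynthesis μ).adjoint

theorem inner_gaussAnalysis_right (h : lp (fun _ : ℕ => ℝ) 2) (v : Lp ℝ 2 μ) :
    inner ℝ h (gaussAnalysis μ v) = inner ℝ (gaussSynthesis μ h) v :=
  ContinuousLinearMap.adjoint_inner_right _ _ _

theorem inner_gaussFeature_gaussAnalysis (x : ℝ) (v : Lp ℝ 2 μ) {g : ℝ → ℝ} (hg : v =ᵐ[μ] g) :
    inner ℝ (gaussFeature x) (gaussAnalysis μ v) = ∫ y, gaussianRBF x y * g y ∂μ := by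
  rw [inner_gaussAnalysis_right, L2.inner_def]
  refine integral_congr_ae ?_
  filter_upwards [gaussSynthesis_coeFn μ (gaussFeature x), hg] with y hy hy'
  rw [hy, hy', inner_gaussFeature, gaussianRBF_comm y x]
  simp [mul_comm]

/-- The integral operator on `L²(μ)` with Gaussian kernel. -/
noncomputable def gaussOp : Lp ℝ 2 μ →L[ℝ] Lp ℝ 2 μ :=
  gaussSynthesis μ ∘L gaussAnalysis μ

theorem gaussOp_coeFn (v : Lp ℝ 2 μ) :
    gaussOp μ v =ᵐ[μ] fun x => inner ℝ (gaussFeature x) (gaussAnalysis μ v) :=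
  gaussSynthesis_coeFn μ _

theorem inner_gaussAnalysis (v w : Lp ℝ 2 μ) :
    inner ℝ (gaussAnalysis μ v) (gaussAnalysis μ w) = inner ℝ (gaussOp μ v) w :=
  inner_gaussAnalysis_right μ _ _

theorem gaussOp_isSymmetric : (gaussOp μ : Lp ℝ 2 μ →ₗ[ℝ] Lp ℝ 2 μ).IsSymmetric := by
  intro v w
  change inner ℝ (gaussOp μ v) w = inner ℝ v (gaussOp μ w)
  rw [← inner_gaussAnalysis, real_inner_comm, inner_gaussAnalysis, real_inner_comm]

/-- ‖S*v‖² = ⟪T v, v⟫, so T and S* have the same kernel, which is orthogonal to the range of S. -/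
theorem gaussAnalysis_eq_zero_of_gaussOp_eq_zero {v : Lp ℝ 2 μ} (hv : gaussOp μ v = 0) :
    gaussAnalysis μ v = 0 := by
  rw [← inner_self_eq_zero (𝕜 := ℝ), inner_gaussAnalysis, hv, inner_zero_left]

theorem inner_gaussSynthesis_eq_zero_of_gaussOp_eq_zero {v : Lp ℝ 2 μ} (hv : gaussOp μ v = 0)
    (h : lp (fun _ : ℕ => ℝ) 2) : inner ℝ v (gaussSynthesis μ h) = 0 := by
  rw [real_inner_comm, ← inner_gaussAnalysis_right,
    gaussAnalysis_eq_zero_of_gaussOp_eq_zero μ hv, inner_zero_right]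

theorem nonneg_of_gaussOp_eq_smul {v : Lp ℝ 2 μ} {lam : ℝ} (hv : gaussOp μ v = lam • v)
    (h0 : v ≠ 0) : 0 ≤ lam := by
  have h1 := inner_gaussAnalysis μ v v
  rw [hv, inner_smul_left, real_inner_self_eq_norm_sq, real_inner_self_eq_norm_sq] at h1
  have h2 : 0 < ‖v‖ ^ 2 := by have := norm_pos_iff.2 h0; positivity
  have h3 : 0 ≤ lam * ‖v‖ ^ 2 := by
    have : 0 ≤ ‖gaussAnalysis μ v‖ ^ 2 := by positivity
    simpa [h1] using this
  exact nonneg_of_mul_nonneg_left h3 h2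

/-- The term is the product of (2M)ⁿ/√n! and 2⁻ⁿ, both square summable. -/
theorem summable_pow_div_sqrt_factorial (M : ℝ) (hM : 0 ≤ M) :
    Summable fun n : ℕ => M ^ n / Real.sqrt (n.factorial : ℝ) := by
  have h1 := Real.summable_pow_div_factorial ((2 * M) ^ 2)
  have h2 := summable_geometric_of_lt_one (r := (1 / 4 : ℝ)) (by norm_num) (by norm_num)
  refine Summable.of_nonneg_of_le (fun n => by positivity) (fun n => ?_) (h1.add h2)
  have h3 : Real.sqrt (n.factorial : ℝ) ^ 2 = n.factorial := Real.sq_sqrt (by positivity)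
  have h4 : (0 : ℝ) < Real.sqrt (n.factorial : ℝ) := Real.sqrt_pos.2 (by positivity)
  have e1 : ((2 * M) ^ 2) ^ n / (n.factorial : ℝ) =
      ((2 * M) ^ n / Real.sqrt (n.factorial : ℝ)) ^ 2 := by
    rw [div_pow, h3, ← pow_mul, ← pow_mul, mul_comm 2 n]
  have e2 : ((1 / 4 : ℝ)) ^ n = ((1 / 2) ^ n) ^ 2 := by
    rw [← pow_mul, mul_comm, pow_mul]; norm_num
  have e3 : M ^ n / Real.sqrt (n.factorial : ℝ) =
      ((2 * M) ^ n / Real.sqrt (n.factorial : ℝ)) * (1 / 2) ^ n := by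
    rw [div_mul_eq_mul_div, ← mul_pow]; ring_nf
  rw [e1, e2, e3]
  have e4 : (0 : ℝ) ≤ (2 * M) ^ n / Real.sqrt (n.factorial : ℝ) := by positivity
  have e5 : (0 : ℝ) ≤ (1 / 2) ^ n := by positivity
  nlinarith [sq_nonneg ((2 * M) ^ n / Real.sqrt (n.factorial : ℝ) - (1 / 2) ^ n), mul_nonneg e4 e5]

theorem inner_gaussFeature_single (x : ℝ) (n : ℕ) (r : ℝ) :
    inner ℝ (gaussFeature x) (lp.single 2 n r) = gaussCoord x n * r := by
  rw [lp.inner_single_right]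
  simp [gaussFeature, mul_comm]

/-- S maps the n-th basis vector to the coordinate function ψₙ, which is at most Mⁿ/√n! for |x| ≤ M.
-/
theorem isCompactOperator_gaussSynthesis {M : ℝ} (hM : 0 ≤ M) (hμ : ∀ᵐ x ∂μ, |x| ≤ M) :
    IsCompactOperator (gaussSynthesis μ) := by
  refine isCompactOperator_of_summable_norm_single _ ?_
  refine Summable.of_nonneg_of_le (fun n => norm_nonneg _) (fun n => ?_)
    ((summable_pow_div_sqrt_factorial M hM).mul_left
      ((measureUnivNNReal μ : ℝ) ^ (2 : ENNReal).toReal⁻¹))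
  refine Lp.norm_le_of_ae_bound (by positivity) ?_
  filter_upwards [hμ, gaussSynthesis_coeFn μ (lp.single 2 n 1)] with x hx hx'
  rw [hx', inner_gaussFeature_single, mul_one, gaussCoord, norm_div, norm_mul, norm_pow,
    Real.norm_of_nonneg (Real.sqrt_nonneg _), Real.norm_of_nonneg (Real.exp_nonneg _)]
  have h1 : Real.exp (-(x ^ 2 / 2)) ≤ 1 := Real.exp_le_one_iff.2 (by nlinarith [sq_nonneg x])
  gcongr
  calc ‖x‖ ^ n * Real.exp (-(x ^ 2 / 2)) ≤ M ^ n * 1 := by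
        gcongr
        exact hx
    _ = M ^ n := mul_one _

theorem isCompactOperator_gaussOp {M : ℝ} (hM : 0 ≤ M) (hμ : ∀ᵐ x ∂μ, |x| ≤ M) :
    IsCompactOperator (gaussOp μ) :=
  (isCompactOperator_gaussSynthesis μ hM hμ).comp_clm (gaussAnalysis μ)

end Operator

/-! ### Spectral theorem and pointwise eigenfunctions. -/

/-- Let `e` be a family of eigenvectors of a compact symmetric operator `T` such that no eigenvector
with nonzero eigenvalue is orthogonal to all of them. A vector orthogonal to `e` and to the kernel
of `T` vanishes. -/
theorem eq_zero_of_orthogonal_eigenvectors {E ι : Type*} [NormedAddCommGroup E]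
    [InnerProductSpace ℝ E] [CompleteSpace E] {T : E →L[ℝ] E} (hT : IsCompactOperator T)
    (hT' : (T : E →ₗ[ℝ] E).IsSymmetric) {e : ι → E} {γ : ι → ℝ} (he : ∀ i, T (e i) = γ i • e i)
    (hmax : ∀ (lam : ℝ) (v : E), lam ≠ 0 → T v = lam • v → (∀ i, inner ℝ (e i) v = 0) → v = 0)
    {g : E} (hg : ∀ i, inner ℝ (e i) g = 0) (hker : ∀ v, T v = 0 → inner ℝ v g = 0) : g = 0 := by
  have hsymm : ∀ v w, inner ℝ (T v) w = inner ℝ v (T w) := hT'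
  let K : Submodule ℝ E := (Submodule.span ℝ (range e))ᗮ
  have hmem : ∀ v, v ∈ K ↔ ∀ i, inner ℝ (e i) v = 0 := by
    intro v
    refine ⟨fun h i => h _ (Submodule.subset_span ⟨i, rfl⟩), fun h w hw => ?_⟩
    induction hw using Submodule.span_induction with
    | mem w hw => obtain ⟨i, rfl⟩ := hw; exact h i
    | zero => exact inner_zero_left _
    | add w w' _ _ h1 h2 => rw [inner_add_left, h1, h2, add_zero]
    | smul r w _ h1 => rw [inner_smul_left, h1, mul_zero]
  have hTK : ∀ v ∈ K, T v ∈ K := by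
    intro v hv
    rw [hmem] at hv ⊢
    intro i
    rw [← hsymm, he, inner_smul_left, hv, mul_zero]
  have hTK' : ∀ v ∈ Kᗮ, T v ∈ Kᗮ := by
    intro v hv w hw
    rw [← hsymm]
    exact hv _ (hTK w hw)
  have : g ∈ (⨆ lam, Module.End.eigenspace (T : Module.End ℝ E) lam)ᗮ := by
    rw [Submodule.iSup_eq_span, Submodule.mem_orthogonal]
    intro w hw
    induction hw using Submodule.span_induction with
    | zero => exact inner_zero_left _
    | add w w' _ _ h1 h2 => rw [inner_add_left, h1, h2, add_zero]
    | smul r w _ h1 => rw [inner_smul_left, h1, mul_zero]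
    | mem v hv =>
      obtain ⟨lam, hv⟩ := mem_iUnion.1 hv
      have hv : T v = lam • v := Module.End.mem_eigenspace_iff.1 hv
      by_cases hl : lam = 0
      · exact hker v (by rw [hv, hl, zero_smul])
      -- Both `K` and `Kᗮ` are `T`-invariant, so the `K`-component of the eigenvector `v` satisfies
      -- the same eigenvalue equation; `hmax` then makes it vanish.
      set p : E := K.starProjection v with hp
      have hpK : p ∈ K := Submodule.starProjection_apply_mem _ _
      have hqK : v - p ∈ Kᗮ := Submodule.sub_starProjection_mem_orthogonal v
      have h1 : T p - lam • p = -(T (v - p) - lam • (v - p)) := by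
        rw [map_sub, hv, smul_sub]; abel
      have h2 : T p - lam • p ∈ K := K.sub_mem (hTK _ hpK) (K.smul_mem _ hpK)
      have h3 : T p - lam • p ∈ Kᗮ := by
        rw [h1]
        exact Kᗮ.neg_mem (Kᗮ.sub_mem (hTK' _ hqK) (Kᗮ.smul_mem _ hqK))
      have h4 : T p - lam • p = 0 := inner_self_eq_zero (𝕜 := ℝ).1 (h3 _ h2)
      have h5 : p = 0 := hmax lam p hl (sub_eq_zero.1 h4) ((hmem p).1 hpK)
      rw [h5, sub_zero] at hqK
      rw [real_inner_comm]
      exact hqK g ((hmem g).2 hg)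
  rwa [ContinuousLinearMap.orthogonalComplement_iSup_eigenspaces_eq_bot hT hT',
    Submodule.mem_bot] at this

theorem inner_Lp_eq_integral {μ : Measure ℝ} (v w : Lp ℝ 2 μ) {f g : ℝ → ℝ} (hf : v =ᵐ[μ] f)
    (hg : w =ᵐ[μ] g) : inner ℝ v w = ∫ x, f x * g x ∂μ := by
  rw [L2.inner_def]
  refine integral_congr_ae ?_
  filter_upwards [hf, hg] with x h1 h2
  rw [h1, h2]
  simp [mul_comm]

section Eigenfunctions

variable {B : Set ℝ} [IsFiniteMeasure (volume.restrict B)] {lam : ℝ}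

theorem SolvesEigenEquation.inner_gaussFeature {v : ℝ → ℝ}
    (hv : SolvesEigenEquation gaussianRBF B lam v) {x : ℝ} (hx : x ∈ B) :
    inner ℝ (gaussFeature x) (gaussAnalysis (volume.restrict B) (hv.1.toLp v)) = lam * v x := by
  rw [inner_gaussFeature_gaussAnalysis _ x _ hv.1.coeFn_toLp, hv.2 x hx]

theorem SolvesEigenEquation.gaussOp_toLp {v : ℝ → ℝ} (hB : MeasurableSet B)
    (hv : SolvesEigenEquation gaussianRBF B lam v) :
    gaussOp (volume.restrict B) (hv.1.toLp v) = lam • hv.1.toLp v := by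
  refine Lp.ext ?_
  filter_upwards [gaussOp_coeFn (volume.restrict B) (hv.1.toLp v), hv.1.coeFn_toLp,
    Lp.coeFn_smul lam (hv.1.toLp v), ae_restrict_mem hB] with x h1 h2 h3 hx
  rw [h1, h3, Pi.smul_apply, h2, hv.inner_gaussFeature hx, smul_eq_mul]

/-- The continuous version of an eigenvector of the integral operator. -/
noncomputable def gaussEigenfunction (μ : Measure ℝ) [IsFiniteMeasure μ] (lam : ℝ)
    (v : Lp ℝ 2 μ) (x : ℝ) : ℝ :=
  lam⁻¹ * inner ℝ (gaussFeature x) (gaussAnalysis μ v)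

theorem coeFn_eq_gaussEigenfunction {μ : Measure ℝ} [IsFiniteMeasure μ] (hl : lam ≠ 0)
    {v : Lp ℝ 2 μ} (hv : gaussOp μ v = lam • v) : v =ᵐ[μ] gaussEigenfunction μ lam v := by
  have h := gaussOp_coeFn μ v
  rw [hv] at h
  filter_upwards [h, Lp.coeFn_smul lam v] with x h1 h2
  rw [gaussEigenfunction, ← h1, h2, Pi.smul_apply, smul_eq_mul, inv_mul_cancel_left₀ hl]

theorem solvesEigenEquation_gaussEigenfunction (hl : lam ≠ 0)
    {v : Lp ℝ 2 (volume.restrict B)} (hv : gaussOp (volume.restrict B) v = lam • v) :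
    SolvesEigenEquation gaussianRBF B lam (gaussEigenfunction (volume.restrict B) lam v) := by
  have h := coeFn_eq_gaussEigenfunction hl hv
  refine ⟨(memLp_congr_ae h).1 (Lp.memLp v), fun x _ => ?_⟩
  rw [← inner_gaussFeature_gaussAnalysis _ x v h, gaussEigenfunction, mul_inv_cancel_left₀ hl]

end Eigenfunctions

/-- A vector in the kernel of `gaussSynthesis` is orthogonal to the features of the interval. -/
theorem inner_gaussFeature_eq_zero_of_gaussSynthesis_eq_zero {p q : ℝ} (hpq : p < q)
    {h : lp (fun _ : ℕ => ℝ) 2} (hh : gaussSynthesis (volume.restrict (Icc p q)) h = 0) :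
    ∀ x ∈ Icc p q, inner ℝ (gaussFeature x) h = 0 := by
  have h1 := gaussSynthesis_coeFn (volume.restrict (Icc p q)) h
  rw [hh] at h1
  have h2 : (fun x => inner ℝ (gaussFeature x) h) =ᵐ[volume.restrict (Icc p q)] fun _ => 0 := by
    filter_upwards [h1, Lp.coeFn_zero ℝ 2 (volume.restrict (Icc p q))] with x h3 h4
    rw [← h3, h4, Pi.zero_apply]
  -- Continuity upgrades almost everywhere to everywhere on a nondegenerate interval.
  exact Measure.eqOn_Icc_of_ae_eq volume hpq.ne h2
    (continuous_gaussFeature.inner continuous_const).continuousOn continuousOn_const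

theorem isCompactOperator_gaussOp_Icc (p q : ℝ) :
    IsCompactOperator (gaussOp (volume.restrict (Icc p q))) := by
  refine isCompactOperator_gaussOp _ (le_max_of_le_left (abs_nonneg p) : 0 ≤ max |p| |q|) ?_
  filter_upwards [ae_restrict_mem measurableSet_Icc] with x hx
  exact abs_le_max_abs_abs hx.1 hx.2

/-! ### Isometric factorization of the Mercer map through the Taylor map. -/

section Orthonormal

variable {H : Type*} [NormedAddCommGroup H] [InnerProductSpace ℝ H] [CompleteSpace H]

/-- Bessel's map: the coordinates with respect to an orthonormal sequence define an operator into
`ℓ²` that preserves the norm of every vector in the closed span of the sequence. -/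
theorem Orthonormal.exists_coordinates {w : ℕ → H} (hw : Orthonormal ℝ w) :
    ∃ U : H →L[ℝ] lp (fun _ : ℕ => ℝ) 2, (∀ h k, U h k = inner ℝ (w k) h) ∧
      ∀ h, (∀ g, (∀ k, inner ℝ (w k) g = 0) → inner ℝ h g = 0) → ‖U h‖ = ‖h‖ := by
  let W : lp (fun _ : ℕ => ℝ) 2 →ₗᵢ[ℝ] H := hw.orthogonalFamily.linearIsometry
  let U : H →L[ℝ] lp (fun _ : ℕ => ℝ) 2 := W.toContinuousLinearMap.adjoint
  have hUW : ∀ h a, inner ℝ (U h) a = inner ℝ h (W a) := fun h a =>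
    ContinuousLinearMap.adjoint_inner_left _ _ _
  have hU : ∀ h k, U h k = inner ℝ (w k) h := by
    intro h k
    have h1 := hUW h (lp.single 2 k 1)
    have h2 : W (lp.single 2 k 1) = w k := by
      simp [W, OrthogonalFamily.linearIsometry_apply_single]
    rw [h2, lp.inner_single_right] at h1
    rw [real_inner_comm, ← h1]
    simp
  refine ⟨U, hU, fun h hh => ?_⟩
  have hUWa : ∀ a, U (W a) = a := by
    intro a
    refine ext_inner_right ℝ fun b => ?_
    rw [hUW, W.inner_map_map]
  -- `g` is the component of `h` orthogonal to the closed span of `w`; the hypothesis on `h` forces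
  -- it to vanish.
  set g : H := h - W (U h) with hg
  have hUg : U g = 0 := by rw [hg, map_sub, hUWa, sub_self]
  have h1 : inner ℝ h g = 0 := hh g fun k => by rw [← hU, hUg]; rfl
  have h2 : inner ℝ (W (U h)) g = 0 := by
    rw [real_inner_comm, ← hUW, hUg, inner_zero_left]
  have h3 : g = 0 := by
    rw [← inner_self_eq_zero (𝕜 := ℝ)]
    nth_rewrite 1 [hg]
    rw [inner_sub_left, h1, h2, sub_zero]
  rw [← W.norm_map, ← sub_eq_zero.1 (hg.symm.trans h3)]

end Orthonormal

section Mercer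

variable {p q : ℝ} {gam : ℕ → ℝ} {u : ℕ → ℝ → ℝ}

theorem IsMercerSystem.gaussSynthesis_eq_zero
    (hM : IsMercerSystem gaussianRBF (Icc p q) gam u) {h : lp (fun _ : ℕ => ℝ) 2}
    (hh : ∀ k, inner ℝ (gaussAnalysis (volume.restrict (Icc p q)) ((hM.eigen k).1.toLp (u k))) h
      = 0) : gaussSynthesis (volume.restrict (Icc p q)) h = 0 := by
  set μ := volume.restrict (Icc p q)
  have hadj : ∀ v, inner ℝ v (gaussSynthesis μ h) = inner ℝ (gaussAnalysis μ v) h := by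
    intro v
    rw [real_inner_comm, ← inner_gaussAnalysis_right, real_inner_comm]
  refine eq_zero_of_orthogonal_eigenvectors (isCompactOperator_gaussOp_Icc p q)
    (gaussOp_isSymmetric _) (e := fun k => (hM.eigen k).1.toLp (u k)) (γ := gam)
    (fun k => (hM.eigen k).gaussOp_toLp measurableSet_Icc) ?_ (fun k => ?_) (fun v hv => ?_)
  · intro lam v hl hv horth
    by_contra h0
    -- `maximal` speaks only of positive eigenvalues; positivity of T = S S* covers all nonzero
    -- ones.
    have hpos : 0 < lam := (nonneg_of_gaussOp_eq_smul μ hv h0).lt_of_ne hl.symm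
    have hve := coeFn_eq_gaussEigenfunction hl hv
    have hz := hM.maximal lam _ hpos (solvesEigenEquation_gaussEigenfunction hl hv) fun k => by
      rw [← inner_Lp_eq_integral _ v (hM.eigen k).1.coeFn_toLp hve]
      exact horth k
    refine h0 (Lp.ext ?_)
    filter_upwards [hve, ae_restrict_mem measurableSet_Icc, Lp.coeFn_zero ℝ 2 μ] with x h1 hx h2
    rw [h1, h2, hz x hx, Pi.zero_apply]
  · rw [hadj]; exact hh k
  · exact inner_gaussSynthesis_eq_zero_of_gaussOp_eq_zero μ hv h

/-- The Mercer feature map is the image of the Taylor feature map under an operator that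
preserves the norms of the increments and of the derivatives of the Taylor feature map. -/
theorem IsMercerSystem.exists_factorization (hpq : p < q)
    (hM : IsMercerSystem gaussianRBF (Icc p q) gam u) :
    ∃ U : lp (fun _ : ℕ => ℝ) 2 →L[ℝ] lp (fun _ : ℕ => ℝ) 2,
      (∀ x ∈ Icc p q, (U (gaussFeature x) : ℕ → ℝ) = mercerCoord gam u x) ∧
      (∀ x ∈ Icc p q, ∀ y ∈ Icc p q,
        ‖U (gaussFeature x) - U (gaussFeature y)‖ = ‖gaussFeature x - gaussFeature y‖) ∧
      ∀ x ∈ Icc p q, ‖U (gaussFeatureDeriv x)‖ = 1 := by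
  set μ := volume.restrict (Icc p q)
  let e : ℕ → Lp ℝ 2 μ := fun k => (hM.eigen k).1.toLp (u k)
  have he : ∀ k, gaussOp μ (e k) = gam k • e k := fun k =>
    (hM.eigen k).gaussOp_toLp measurableSet_Icc
  have hs : ∀ k, 0 < Real.sqrt (gam k) := fun k => Real.sqrt_pos.2 (hM.pos k)
  have hss : ∀ k, Real.sqrt (gam k) * Real.sqrt (gam k) = gam k := fun k =>
    Real.mul_self_sqrt (hM.pos k).le
  -- The scaling comes from ⟪S*eⱼ, S*eₖ⟫ = ⟪T eⱼ, eₖ⟫ = γⱼ δⱼₖ.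
  let w : ℕ → lp (fun _ : ℕ => ℝ) 2 := fun k => (Real.sqrt (gam k))⁻¹ • gaussAnalysis μ (e k)
  have hw : Orthonormal ℝ w := by
    rw [orthonormal_iff_ite]
    intro j k
    have h1 : inner ℝ (e j) (e k) = if j = k then (1 : ℝ) else 0 := by
      rw [inner_Lp_eq_integral _ _ (hM.eigen j).1.coeFn_toLp (hM.eigen k).1.coeFn_toLp]
      exact hM.orthonormal j k
    simp only [w]
    rw [inner_smul_left, inner_smul_right, inner_gaussAnalysis, he, inner_smul_left, h1]
    simp only [conj_trivial]
    split_ifs with hjk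
    · subst hjk
      rw [mul_one, inv_mul_eq_div, inv_mul_eq_div, div_div, hss, div_self (hM.pos j).ne']
    · simp
  obtain ⟨U, hU, hUnorm⟩ := hw.exists_coordinates
  have hzero : ∀ g, (∀ k, inner ℝ (w k) g = 0) → ∀ x ∈ Icc p q,
      inner ℝ (gaussFeature x) g = 0 := by
    intro g hg
    refine inner_gaussFeature_eq_zero_of_gaussSynthesis_eq_zero hpq
      (hM.gaussSynthesis_eq_zero fun k => ?_)
    have := hg k
    rw [inner_smul_left] at this
    exact (mul_eq_zero.1 this).resolve_left (by simpa using (hs k).ne')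
  refine ⟨U, fun x hx => ?_, fun x hx y hy => ?_, fun x hx => ?_⟩
  · ext k
    rw [hU, mercerCoord, real_inner_comm, inner_smul_right, (hM.eigen k).inner_gaussFeature hx]
    have := (hs k).ne'
    nth_rewrite 2 [← hss k]
    field_simp
  · rw [← map_sub]
    refine hUnorm _ fun g hg => ?_
    rw [inner_sub_left, hzero g hg x hx, hzero g hg y hy, sub_zero]
  · rw [← norm_gaussFeatureDeriv x]
    refine hUnorm _ fun g hg => ?_
    -- The pairing with `g` is known to vanish only on the interval, so derivatives within it are
    -- compared, which also covers the end points.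
    have h1 : HasDerivWithinAt (fun y => inner ℝ (gaussFeature y) g)
        (inner ℝ (gaussFeatureDeriv x) g) (Icc p q) x := by
      simpa using ((hasDerivAt_gaussFeature x).inner ℝ (hasDerivAt_const x g)).hasDerivWithinAt
    have h2 : HasDerivWithinAt (fun y => inner ℝ (gaussFeature y) g) 0 (Icc p q) x :=
      (hasDerivWithinAt_const x (Icc p q) (0 : ℝ)).congr (fun y hy => hzero g hg y hy)
        (hzero g hg x hx)
    exact (uniqueDiffOn_Icc hpq x hx).eq_deriv _ h1 h2

theorem IsMercerSystem.isEmbedding_and_isNonDistortiveOn (hpq : p < q)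
    (hM : IsMercerSystem gaussianRBF (Icc p q) gam u) {a b : ℝ} (hab : Icc a b ⊆ Icc p q) :
    (∀ z ∈ Icc a b, Memℓp (mercerCoord gam u z) 2) ∧
      Topology.IsEmbedding (fun z : Icc a b => mercerMap gam u z) ∧
      IsNonDistortiveOn (mercerMap gam u) (Icc a b) := by
  obtain ⟨U, hU, hUnorm, hUderiv⟩ := hM.exists_factorization hpq
  have hmem : ∀ z ∈ Icc a b, Memℓp (mercerCoord gam u z) 2 := fun z hz => by
    rw [← hU z (hab hz)]
    exact lp.memℓp _
  have hmap : ∀ z ∈ Icc a b, mercerMap gam u z = U (gaussFeature z) := fun z hz => by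
    rw [mercerMap, dif_pos (hmem z hz)]
    exact Subtype.ext (hU z (hab hz)).symm
  refine ⟨hmem, ?_, ?_⟩
  · have hfun : (fun z : Icc a b => mercerMap gam u z) = fun z : Icc a b => U (gaussFeature z) :=
      funext fun z => hmap z z.2
    rw [hfun]
    -- A continuous injection from a compact space to a Hausdorff space is an embedding.
    refine (Continuous.isClosedEmbedding ?_ ?_).isEmbedding
    · exact U.continuous.comp (continuous_gaussFeature.comp continuous_subtype_val)
    · intro x y hxy
      have h1 := hUnorm x (hab x.2) y (hab y.2)
      simp only at hxy
      rw [hxy, sub_self, norm_zero, eq_comm, norm_eq_zero, sub_eq_zero] at h1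
      exact Subtype.ext (gaussFeature_injective h1)
  · intro η hη hηZ
    -- Off [0, 1] the curve may leave the interval, where `mercerMap` is uncontrolled; hence
    -- equality only on [0, 1].
    have hcongr : EqOn (mercerMap gam u ∘ η) (fun t => U (gaussFeature (η t))) (Icc 0 1) :=
      fun t ht => hmap _ (hηZ ht)
    have hC1 : ContDiff ℝ 1 gaussFeature := by
      rw [contDiff_one_iff_deriv]
      refine ⟨fun x => (hasDerivAt_gaussFeature x).differentiableAt, ?_⟩
      rw [show deriv gaussFeature = gaussFeatureDeriv from
        funext fun x => (hasDerivAt_gaussFeature x).deriv]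
      exact continuous_gaussFeatureDeriv
    refine ⟨((U.contDiff.comp hC1).comp_contDiffOn hη).congr hcongr, ?_⟩
    refine intervalIntegral.integral_congr fun t ht => ?_
    rw [uIcc_of_le zero_le_one] at ht
    have h1 : HasDerivWithinAt η (derivWithin η (Icc 0 1) t) (Icc 0 1) t :=
      (hη.differentiableOn one_ne_zero t ht).hasDerivWithinAt
    have h2 := (hasDerivAt_gaussFeature (η t)).scomp_hasDerivWithinAt t h1
    have h3 := U.hasFDerivAt.comp_hasDerivWithinAt t h2
    have h4 := (h3.congr hcongr (hcongr ht)).derivWithin (uniqueDiffOn_Icc zero_lt_one t ht)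
    rw [h4, map_smul, norm_smul, hUderiv _ (hab (hηZ ht)), mul_one]

end Mercer

/-! ### Existence of an infinite Mercer system. -/

/-- The linear map from polynomials to `ℓ²` such that the pairing of the image of `P` with the
Taylor feature map at `x` is `P(x) exp(-x²/2)`. -/
noncomputable def polynomialToL2 : Polynomial ℝ →ₗ[ℝ] lp (fun _ : ℕ => ℝ) 2 :=
  (Polynomial.basisMonomials ℝ).constr ℝ fun n => lp.single 2 n (Real.sqrt (n.factorial : ℝ))

theorem inner_gaussFeature_polynomialToL2 (x : ℝ) (P : Polynomial ℝ) :
    inner ℝ (gaussFeature x) (polynomialToL2 P) = P.eval x * Real.exp (-(x ^ 2 / 2)) := by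
  induction P using Polynomial.induction_on' with
  | add P Q hP hQ => rw [map_add, inner_add_right, hP, hQ, Polynomial.eval_add, add_mul]
  | monomial n r =>
    have h1 : Polynomial.monomial n r = r • Polynomial.basisMonomials ℝ n := by
      simp [Polynomial.smul_monomial]
    have h2 : Real.sqrt (n.factorial : ℝ) ≠ 0 := (Real.sqrt_pos.2 (by positivity)).ne'
    rw [Polynomial.eval_monomial, h1, map_smul, polynomialToL2, Module.Basis.constr_basis,
      inner_smul_right, inner_gaussFeature_single, gaussCoord, div_mul_cancel₀ _ h2, mul_assoc]

/-- P(x) exp(-x²/2) vanishes on an interval only if P has infinitely many roots. This embeds an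
infinite-dimensional space into the range of S. -/
theorem gaussSynthesis_polynomialToL2_eq_zero {p q : ℝ} (hpq : p < q) {P : Polynomial ℝ}
    (hP : gaussSynthesis (volume.restrict (Icc p q)) (polynomialToL2 P) = 0) : P = 0 := by
  refine Polynomial.eq_zero_of_infinite_isRoot P ((Icc_infinite hpq).mono fun x hx => ?_)
  have h := inner_gaussFeature_eq_zero_of_gaussSynthesis_eq_zero hpq hP x hx
  rw [inner_gaussFeature_polynomialToL2] at h
  exact (mul_eq_zero.1 h).resolve_right (Real.exp_ne_zero _)

section Existence

variable {E : Type*} [NormedAddCommGroup E] [InnerProductSpace ℝ E]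

/-- Every operator has an orthonormal set of eigenvectors with positive eigenvalues that cannot be
extended: an eigenvector with a positive eigenvalue orthogonal to it vanishes. -/
theorem exists_maximal_orthonormal_eigenvectors (T : E →L[ℝ] E) :
    ∃ m : Set E, Orthonormal ℝ (Subtype.val : m → E) ∧
      (∀ v ∈ m, ∃ lam : ℝ, 0 < lam ∧ T v = lam • v) ∧
      ∀ (lam : ℝ) (v : E), 0 < lam → T v = lam • v → (∀ e ∈ m, inner ℝ e v = 0) → v = 0 := by
  obtain ⟨m, hm⟩ := zorn_subset {s : Set E | Orthonormal ℝ (Subtype.val : s → E) ∧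
      ∀ v ∈ s, ∃ lam : ℝ, 0 < lam ∧ T v = lam • v} fun c hc hchain =>
    ⟨⋃₀ c, ⟨orthonormal_sUnion_of_directed hchain.directedOn fun s hs => (hc hs).1,
      fun v ⟨s, hs, hv⟩ => (hc hs).2 v hv⟩, fun s hs => subset_sUnion_of_mem hs⟩
  obtain ⟨⟨hortho, heig⟩, hmax⟩ := hm
  refine ⟨m, hortho, heig, fun lam v hl hv horth => ?_⟩
  by_contra h0
  have hn : ‖v‖ ≠ 0 := norm_ne_zero_iff.2 h0
  have hortho' : ∀ e ∈ m, inner ℝ e (‖v‖⁻¹ • v) = 0 := fun e he => by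
    rw [inner_smul_right, horth e he, mul_zero]
  have hself : inner ℝ (‖v‖⁻¹ • v) (‖v‖⁻¹ • v) = 1 := by
    rw [real_inner_self_eq_norm_sq, norm_smul, norm_inv, norm_norm, inv_mul_cancel₀ hn, one_pow]
  have hnot : ‖v‖⁻¹ • v ∉ m := fun h => by
    rw [hortho' _ h] at hself
    exact zero_ne_one hself
  refine hnot (hmax (y := insert (‖v‖⁻¹ • v) m) ⟨?_, ?_⟩ (subset_insert _ _) (mem_insert _ _))
  · classical
    rw [orthonormal_subtype_iff_ite] at hortho ⊢
    rintro x (rfl | hx) y (rfl | hy)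
    · rw [hself, if_pos rfl]
    · rw [real_inner_comm, hortho' y hy, if_neg (ne_of_mem_of_not_mem hy hnot).symm]
    · rw [hortho' x hx, if_neg (ne_of_mem_of_not_mem hx hnot)]
    · exact hortho x hx y hy
  · rintro x (rfl | hx)
    · exact ⟨lam, hl, by rw [map_smul, hv, smul_comm]⟩
    · exact heig x hx

end Existence

/-- By Bessel, the image under S of each basis vector pairs nontrivially with only countably many
members of `m`. A member missed by all of these images is killed by S*, hence by T. -/
theorem countable_of_orthonormal_gaussOp_ne_zero {μ : Measure ℝ} [IsFiniteMeasure μ]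
    {m : Set (Lp ℝ 2 μ)} (hm : Orthonormal ℝ (Subtype.val : m → Lp ℝ 2 μ))
    (hne : ∀ v ∈ m, gaussOp μ v ≠ 0) : Countable m := by
  have hsupp : ∀ n : ℕ, (Function.support fun e : m =>
      ‖(inner ℝ (e : Lp ℝ 2 μ) (gaussSynthesis μ (lp.single 2 n 1)) : ℝ)‖ ^ 2).Countable :=
    fun n => (hm.inner_products_summable _).countable_support
  rw [← countable_univ_iff]
  refine (countable_iUnion hsupp).mono fun e _ => ?_
  by_contra hcon
  simp only [mem_iUnion, Function.mem_support, not_exists, not_not] at hcon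
  refine hne e e.2 ?_
  have h0 : gaussAnalysis μ (e : Lp ℝ 2 μ) = 0 := by
    ext n
    have h1 := inner_gaussAnalysis_right μ (lp.single 2 n 1) e
    have h2 : inner ℝ (gaussSynthesis μ (lp.single 2 n 1)) (e : Lp ℝ 2 μ) = 0 := by
      rw [real_inner_comm]
      exact norm_eq_zero.1 (pow_eq_zero_iff two_ne_zero |>.1 (hcon n))
    rw [lp.inner_single_left, h2] at h1
    simpa using h1
  rw [gaussOp, ContinuousLinearMap.comp_apply, h0, map_zero]

/-- If `m` were finite, pairing with `m` would map the polynomials to a finite-dimensional space.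
This map is injective: an element of the range of S orthogonal to `m` is also orthogonal to ker T,
hence zero. -/
theorem infinite_of_maximal_eigenvectors {p q : ℝ} (hpq : p < q)
    {m : Set (Lp ℝ 2 (volume.restrict (Icc p q)))}
    (heig : ∀ v ∈ m, ∃ lam : ℝ, 0 < lam ∧ gaussOp (volume.restrict (Icc p q)) v = lam • v)
    (hmax : ∀ (lam : ℝ) (v : Lp ℝ 2 (volume.restrict (Icc p q))), 0 < lam →
      gaussOp (volume.restrict (Icc p q)) v = lam • v → (∀ e ∈ m, inner ℝ e v = 0) → v = 0) :
    Infinite m := by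
  rw [← not_finite_iff_infinite]
  intro hfin
  choose! lam hlam using heig
  let F : Polynomial ℝ →ₗ[ℝ] (m → ℝ) := LinearMap.pi fun e =>
    (innerSL ℝ (e : Lp ℝ 2 (volume.restrict (Icc p q)))).toLinearMap ∘ₗ
      (gaussSynthesis _).toLinearMap ∘ₗ polynomialToL2
  refine Polynomial.not_finite (R := ℝ) (Module.Finite.of_injective F ?_)
  rw [← LinearMap.ker_eq_bot, LinearMap.ker_eq_bot']
  intro P hP
  refine gaussSynthesis_polynomialToL2_eq_zero hpq ?_
  refine eq_zero_of_orthogonal_eigenvectors (isCompactOperator_gaussOp_Icc p q)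
    (gaussOp_isSymmetric _) (e := fun e : m => (e : Lp ℝ 2 (volume.restrict (Icc p q))))
    (γ := fun e => lam e)
    (fun e => (hlam e e.2).2) ?_ (fun e => congrFun hP e)
    fun v hv => inner_gaussSynthesis_eq_zero_of_gaussOp_eq_zero _ hv _
  intro l v hl hv horth
  by_contra h0
  exact h0 (hmax l v ((nonneg_of_gaussOp_eq_smul _ hv h0).lt_of_ne hl.symm) hv
    fun e he => horth ⟨e, he⟩)

theorem exists_isMercerSystem {p q : ℝ} (hpq : p < q) :
    ∃ (gam : ℕ → ℝ) (u : ℕ → ℝ → ℝ), IsMercerSystem gaussianRBF (Icc p q) gam u := by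
  set μ := volume.restrict (Icc p q)
  obtain ⟨m, hortho, heig, hmax⟩ := exists_maximal_orthonormal_eigenvectors (gaussOp μ)
  have hinf : Infinite m := infinite_of_maximal_eigenvectors hpq heig hmax
  choose! lam hlam using heig
  have hcount : Countable m := by
    refine countable_of_orthonormal_gaussOp_ne_zero hortho fun v hv => ?_
    rw [(hlam v hv).2]
    exact smul_ne_zero (hlam v hv).1.ne' (hortho.ne_zero ⟨v, hv⟩)
  obtain ⟨hden⟩ := nonempty_denumerable m
  let f : ℕ ≃ m := (Denumerable.eqv m).symm
  have hpos : ∀ k, 0 < lam (f k) := fun k => (hlam _ (f k).2).1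
  have heq : ∀ k, gaussOp μ (f k) = lam (f k) • (f k : Lp ℝ 2 μ) := fun k => (hlam _ (f k).2).2
  have hae := fun k => coeFn_eq_gaussEigenfunction (hpos k).ne' (heq k)
  refine ⟨fun k => lam (f k), fun k => gaussEigenfunction μ (lam (f k)) (f k), hpos,
    fun k => solvesEigenEquation_gaussEigenfunction (hpos k).ne' (heq k), fun j k => ?_,
    fun l v hl hv horth x hx => ?_⟩
  · classical
    rw [← inner_Lp_eq_integral _ _ (hae j) (hae k)]
    have := orthonormal_iff_ite.1 hortho (f j) (f k)
    simpa only [f.injective.eq_iff] using this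
  -- Maximality in L² kills only the class of `v`; the eigenvalue equation at each point then gives
  -- `v x = 0` there.
  · have hz : hv.1.toLp v = 0 := by
      refine hmax l _ hl (hv.gaussOp_toLp measurableSet_Icc) fun e he => ?_
      obtain ⟨k, hk⟩ := f.surjective ⟨e, he⟩
      have hk' : (f k : Lp ℝ 2 μ) = e := congrArg Subtype.val hk
      rw [← hk', inner_Lp_eq_integral _ _ (hae k) hv.1.coeFn_toLp]
      exact horth k
    have h := hv.inner_gaussFeature hx
    rw [hz, map_zero, inner_zero_right] at h
    exact (mul_eq_zero.1 h.symm).resolve_left hl.ne'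

theorem proposition1 (a b c R : ℝ) (hab : a < b) (hB : Icc a b ⊆ Metric.closedBall c R) :
    (∃ (gam : ℕ → ℝ) (u : ℕ → ℝ → ℝ),
      IsMercerSystem gaussianRBF (Metric.closedBall c R) gam u) ∧
    ∀ (gam : ℕ → ℝ) (u : ℕ → ℝ → ℝ),
      IsMercerSystem gaussianRBF (Metric.closedBall c R) gam u →
        (∀ z ∈ Icc a b, Memℓp (mercerCoord gam u z) 2) ∧
        Topology.IsEmbedding (fun z : Icc a b => mercerMap gam u z) ∧
        IsNonDistortiveOn (mercerMap gam u) (Icc a b) := by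
  rw [Real.closedBall_eq_Icc] at hB ⊢
  have hlt : c - R < c + R :=
    (hB (left_mem_Icc.2 hab.le)).1.trans_lt (hab.trans_le (hB (right_mem_Icc.2 hab.le)).2)
  exact ⟨exists_isMercerSystem hlt, fun _ _ hM => hM.isEmbedding_and_isNonDistortiveOn hlt hB⟩
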